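/- Let $0\le T_0<T$, $\widetilde T=T-T_0$, $r\ge 0$, $\mu\in\mathbb R$, $\alpha<0$, $\beta>0$, $0<\gamma<1$, and let $\sigma:\mathbb R\to\mathbb R$ be bounded and differentiable with bounded derivative and $\inf_{y}\sigma(y)>0$. Put $q_*=1/(1-\gamma)$, $$Q(y)=\gamma\Big(r+\frac{(\mu-r)^2}{2(1-\gamma)\,\sigma(y)^2}\Big),\qquad Q_*=\sup_{y\in\mathbb R}Q(y),\qquad r^*=(\widetilde T+1)\,e^{Q_*\widetilde T}.$$ Let $U$ be a standard real Brownian motion and, for $t\in[T_0,T]$ and $y\in\mathbb R$, let $(\eta^{t,y}_s)_{t\le s\le T}$ be the continuous solution of $d\eta_s=\alpha\eta_s\,ds+\beta\,dU_s$, $\eta_t=y$. Let $\mathcal K=[T_0,T]\times\mathbb R$, let $\mathcal X$ be the set of continuous functions $f:\mathcal K\to[1,r^*]$, and define the Feynman–Kac operator by $$\mathcal L_f(t,y)=\mathbb E\,\mathcal G(t,T,y)+\frac1{q_*}\int_t^T\mathbb E\Big[\big(f(s,\eta^{t,y}_s)\big)^{1-q_*}\,\mathcal G(t,s,y)\Big]ds,\qquad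 \mathcal G(t,s,y)=\exp\Big(\int_t^sQ(\eta^{t,y}_u)\,du\Big).$$ For $\zeta>0$ put $\varkappa=Q_*+\zeta+1$, $\lambda=1/(1+\zeta)$ and $$\varrho_*(f,g)=\sup_{(t,y)\in\mathcal K}e^{-\varkappa(T-t)}|f(t,y)-g(t,y)|,\qquad B^*=\frac{e^{\varkappa\widetilde T}(1+r^*)}{1-\lambda}.$$ Then: 1. $\mathcal L$ maps $\mathcal X$ into $\mathcal X$, and for every $\zeta>0$ and all $f,g\in\mathcal X$, $\varrho_*(\mathcal L_f,\mathcal L_g)\le\lambda\,\varrho_*(f,g)$. 2. The fixed-point problem $\mathcal L_h=h$ has a unique solution $h$ in $\mathcal X$. 3. The iterates $h_0\equiv1$, $h_n=\mathcal L_{h_{n-1}}$ ($n\ge1$) satisfy, for every $\zeta>0$ and every $n\ge0$, $$\sup_{(t,y)\in\mathcal K}|h(t,y)-h_n(t,y)|\le B^*\lambda^n .$$ -/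

import Mathlib

open MeasureTheory ProbabilityTheory Set
open scoped NNReal

noncomputable section

/-- The parameters of the market with an Ornstein–Uhlenbeck volatility factor, with their
standing assumptions. -/
structure OUMarket where
  /-- start of the optimization interval -/
  T₀ : ℝ
  /-- maturity -/
  T : ℝ
  /-- riskless interest rate -/
  r : ℝ
  /-- stock price appreciation rate -/
  μ : ℝ
  /-- volatility, as a function of the factor -/
  σ : ℝ → ℝ
  /-- drift parameter of the factor -/
  α : ℝ
  /-- diffusion parameter of the factor -/
  β : ℝ
  /-- exponent of the power utility -/
  γ : ℝ
  T₀_nonneg : 0 ≤ T₀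
  T₀_lt_T : T₀ < T
  r_nonneg : 0 ≤ r
  σ_lower : ∃ σ₁ > 0, ∀ y, σ₁ ≤ σ y
  σ_bounded : ∃ C, ∀ y, σ y ≤ C
  σ_differentiable : Differentiable ℝ σ
  σ_deriv_bounded : ∃ C, ∀ y, |deriv σ y| ≤ C
  α_neg : α < 0
  β_pos : 0 < β
  γ_pos : 0 < γ
  γ_lt_one : γ < 1

namespace OUMarket

variable (M : OUMarket)

/-- The length of the interval `[T₀, T]`. -/
def Ttilde : ℝ := M.T - M.T₀

/-- The risk premium `θ(y) = (μ - r) / σ(y)`. -/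
def θ (y : ℝ) : ℝ := (M.μ - M.r) / M.σ y

/-- The exponent `q_* = 1 / (1 - γ)`. -/
def qStar : ℝ := 1 / (1 - M.γ)

/-- The potential `Q(y) = γ (r + |θ(y)|² / (2 (1 - γ)))`. -/
def Q (y : ℝ) : ℝ := M.γ * (M.r + |M.θ y| ^ 2 / (2 * (1 - M.γ)))

/-- `Q_* = sup_y Q(y)`; the supremum is finite because `σ` is bounded away from `0`. -/
def QStar : ℝ := ⨆ y : ℝ, M.Q y

/-- `r^* = (T̃ + 1) exp(Q_* T̃)`. -/
def rStar : ℝ := (M.Ttilde + 1) * Real.exp (M.QStar * M.Ttilde)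

/-- The strip `[T₀, T] × ℝ`. -/
abbrev K : Type := Icc M.T₀ M.T × ℝ

/-- The set of continuous functions on `[T₀, T] × ℝ` with values in `[1, r^*]`. -/
def X : Set (M.K → ℝ) :=
  {f | Continuous f ∧ ∀ p, 1 ≤ f p ∧ f p ≤ M.rStar}

/-- `ϰ = Q_* + ζ + 1`. -/
def kappa (ζ : ℝ) : ℝ := M.QStar + ζ + 1

/-- The metric `ϱ_*(f, g) = sup_{(t,y)} exp(-ϰ (T - t)) |f(t,y) - g(t,y)|` on `X`
(the supremum of a bounded family when `f` and `g` are in `X`). -/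
def rhoStar (ζ : ℝ) (f g : M.K → ℝ) : ℝ :=
  ⨆ p : M.K, Real.exp (-M.kappa ζ * (M.T - (p.1 : ℝ))) * |f p - g p|

/-- The constant `B^* = exp(ϰ T̃) (1 + r^*) / (1 - λ)` with `λ = 1 / (1 + ζ)`. -/
def BStar (ζ : ℝ) : ℝ :=
  Real.exp (M.kappa ζ * M.Ttilde) * (1 + M.rStar) / (1 - 1 / (1 + ζ))

variable {Ω : Type*} [MeasurableSpace Ω]

/-- For all `t ∈ [T₀, T]` and `y`, the process `η t y = (η_s^{t,y})_{t ≤ s ≤ T}` is the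
continuous solution of `dη_s = α η_s ds + β dU_s`, `η_t = y`. As the noise is additive, the
equation in integral form reads
`η_s = y + α ∫_t^s η_u du + β (U_s - U_t)` for all `s ∈ [t, T]`, almost surely. -/
def IsOUFlow (P : Measure Ω) (U : ℝ≥0 → Ω → ℝ) (η : ℝ → ℝ → ℝ → Ω → ℝ) : Prop :=
  ∀ t ∈ Icc M.T₀ M.T, ∀ y : ℝ, ∀ᵐ ω ∂P,
    ContinuousOn (fun s => η t y s ω) (Icc t M.T) ∧
    ∀ s ∈ Icc t M.T,
      η t y s ω = y + M.α * (∫ u in t..s, η t y u ω)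
        + M.β * (U s.toNNReal ω - U t.toNNReal ω)

/-- `𝒢(t, s, y) = exp(∫_t^s Q(η_u^{t,y}) du)`. -/
def G (η : ℝ → ℝ → ℝ → Ω → ℝ) (t s y : ℝ) (ω : Ω) : ℝ :=
  Real.exp (∫ u in t..s, M.Q (η t y u ω))

/-- `ℋ_f(t, s, y) = 𝔼 [ f(s, η_s^{t,y})^{1 - q_*} 𝒢(t, s, y) ]` for `T₀ ≤ t ≤ s ≤ T`.
On such `s` the projection `projIcc` onto `[T₀, T]` is the identity. -/
def H (P : Measure Ω) (η : ℝ → ℝ → ℝ → Ω → ℝ) (f : M.K → ℝ) (t s y : ℝ) : ℝ :=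
  ∫ ω, (f (projIcc M.T₀ M.T M.T₀_lt_T.le s, η t y s ω)) ^ (1 - M.qStar)
    * M.G η t s y ω ∂P

/-- The Feynman–Kac operator
`ℒ_f(t, y) = 𝔼 𝒢(t, T, y) + (1 / q_*) ∫_t^T ℋ_f(t, s, y) ds`. -/
def feynmanKac (P : Measure Ω) (η : ℝ → ℝ → ℝ → Ω → ℝ) (f : M.K → ℝ) : M.K → ℝ :=
  fun p => (∫ ω, M.G η p.1 M.T p.2 ω ∂P)
    + 1 / M.qStar * ∫ s in (p.1 : ℝ)..M.T, M.H P η f p.1 s p.2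

/-- The Picard iterates `h_0 ≡ 1`, `h_{n+1} = ℒ_{h_n}`. -/
def picard (P : Measure Ω) (η : ℝ → ℝ → ℝ → Ω → ℝ) : ℕ → M.K → ℝ
  | 0 => fun _ => 1
  | n + 1 => M.feynmanKac P η (picard P η n)

end OUMarket

end

/-!
The noise enters the equation for `η` additively, so subtracting two solutions with the same
driving path leaves a linear Volterra equation without noise, which has only the zero solution.
Hence every solution is indistinguishable from the explicit flow
`Z(t, y, s) = O(s) + e^{α(s-t)} (y - O(t))`, where `O` is a single Ornstein–Uhlenbeck path, built
from a version of the Brownian motion all of whose paths are continuous and all of whose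
coordinates are measurable (`exists_continuousField`). The operator only sees the
indistinguishability class of `η` at each starting point (`feynmanKac_congr`), so `η` may be
replaced by `Z`, which is jointly continuous in `(t, y, s)` for every `ω`.

As `0 ≤ Q ≤ Q_*`, the functional `𝒢(t, s, y)` lies in `[1, e^{Q_*(s-t)}]` for `t ≤ s`, and
`f ^ (1 - q_*) ∈ (0, 1]` because `f ≥ 1` and `q_* > 1`. These bounds give `1 ≤ ℒ_f ≤ r^*`, and
with dominated convergence they give the continuity of `ℒ_f` (`feynmanKac_mem_X_of_field`).

For the contraction, `x ↦ x ^ (1 - q_*)` is Lipschitz on `[1, ∞)` with constant `q_* - 1`, so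
`|ℒ_f - ℒ_g|(t, y)` is at most
`((q_* - 1) / q_*) ϱ_*(f, g) ∫_t^T e^{ϰ(T-s)} e^{Q_*(s-t)} ds`, and since `ϰ - Q_* = 1 + ζ` this is
at most `e^{ϰ(T-t)} ϱ_*(f, g) / (1 + ζ)` (`abs_feynmanKac_sub_le`).

The fixed point is the uniform limit of the Picard iterates. Since
`e^{-ϰT̃} ‖f - g‖_∞ ≤ ϱ_*(f, g) ≤ ‖f - g‖_∞`, the steps of the iteration decay geometrically in the
sup norm for every `ζ`, which yields the same limit for all `ζ` and the rate with the constant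
`B^*` (`exists_fixedPoint`).
-/

/-! ### A regular version of the Ornstein–Uhlenbeck flow -/

/-- A process with almost surely continuous paths agrees, outside a null set, with a process all
of whose paths are continuous and all of whose coordinates are measurable. -/
theorem exists_continuous_measurable_version {ι Ω : Type*} [TopologicalSpace ι]
    [TopologicalSpace.SeparableSpace ι] [FrechetUrysohnSpace ι] [MeasurableSpace Ω] {P : Measure Ω}
    {X : ι → Ω → ℝ} (hm : ∀ t, AEMeasurable (X t) P) (hc : ∀ᵐ ω ∂P, Continuous (X · ω)) :
    ∃ V : ι → Ω → ℝ, (∀ ω, Continuous (V · ω)) ∧ (∀ t, Measurable (V t)) ∧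
      ∀ᵐ ω ∂P, ∀ t, V t ω = X t ω := by
  obtain ⟨D, hD, hDd⟩ := TopologicalSpace.exists_countable_dense ι
  have hmk : ∀ᵐ ω ∂P, ∀ t ∈ D, X t ω = (hm t).mk (X t) ω :=
    (ae_ball_iff hD).2 fun t _ => (hm t).ae_eq_mk
  -- `N` is a measurable null set off which the path is continuous and agrees on `D` with the
  -- measurable representatives.
  set N : Set Ω := toMeasurable P
    {ω | ¬ (Continuous (X · ω) ∧ ∀ t ∈ D, X t ω = (hm t).mk (X t) ω)} with hN
  have hNm : MeasurableSet N := measurableSet_toMeasurable _ _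
  have hN0 : P N = 0 := by
    rw [hN, measure_toMeasurable]
    exact (hc.and hmk)
  have hgood : ∀ ω, ω ∉ N → Continuous (X · ω) ∧ ∀ t ∈ D, X t ω = (hm t).mk (X t) ω := by
    intro ω hω
    by_contra h
    exact hω (subset_toMeasurable _ _ h)
  have hcont : ∀ ω, Continuous fun t => Nᶜ.indicator (X t) ω := by
    intro ω
    by_cases hω : ω ∈ N
    · simpa [hω] using continuous_const
    · simpa [hω] using (hgood ω hω).1
  refine ⟨fun t => Nᶜ.indicator (X t), hcont, fun t => ?_, ?_⟩
  · obtain ⟨u, huD, hut⟩ := mem_closure_iff_seq_limit.1 (hDd t)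
    refine measurable_of_tendsto_metrizable (f := fun n => Nᶜ.indicator (X (u n))) (fun n => ?_)
      (tendsto_pi_nhds.2 fun ω => ((hcont ω).tendsto t).comp hut)
    have : Nᶜ.indicator (X (u n)) = Nᶜ.indicator ((hm (u n)).mk (X (u n))) :=
      indicator_congr fun ω hω => (hgood ω hω).2 _ (huD n)
    rw [this]
    exact (hm (u n)).measurable_mk.indicator hNm.compl
  · filter_upwards [compl_mem_ae_iff.2 hN0] with ω hω t
    exact indicator_of_mem hω _

/-- The linear Volterra equation `D(s) = a ∫_t^s D` has only the zero solution. -/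
theorem eqOn_zero_of_eq_mul_integral {a t T : ℝ} {D : ℝ → ℝ} (hD : ContinuousOn D (Icc t T))
    (h : ∀ s ∈ Icc t T, D s = a * ∫ u in t..s, D u) : ∀ s ∈ Icc t T, D s = 0 := by
  intro s₀ hs₀
  have htT : t ≤ T := hs₀.1.trans hs₀.2
  refine eq_zero_of_abs_deriv_le_mul_abs_self_of_eq_zero_right (f' := fun s => a * D s)
    (K := |a|) hD (fun s hs => ?_) ?_ (fun s _ => by simp) s₀ hs₀
  · have hd : HasDerivWithinAt (fun s => a * ∫ u in t..s, D u) (a * D s) (Ici s) s := by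
      refine HasDerivWithinAt.const_mul a ?_
      have hint : IntervalIntegrable D volume t s :=
        (hD.mono (Icc_subset_Icc_right hs.2.le)).intervalIntegrable_of_Icc hs.1
      have hcs : ContinuousWithinAt D (Ioc s T) s :=
        (hD s ⟨hs.1, hs.2.le⟩).mono fun x hx => ⟨hs.1.trans hx.1.le, hx.2⟩
      refine intervalIntegral.integral_hasDerivWithinAt_right (t := Ioi s) hint
        (ContinuousOn.stronglyMeasurableAtFilter_nhdsWithin
          (s := Icc t T) hD measurableSet_Icc s |>.filter_mono ?_) ?_
      · exact nhdsWithin_le_iff.2 (mem_nhdsWithin.2 ⟨Iio T, isOpen_Iio, hs.2, fun x hx =>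
          ⟨hs.1.trans (le_of_lt hx.2), le_of_lt hx.1⟩⟩)
      · exact hcs.mono_of_mem_nhdsWithin (Ioc_mem_nhdsGT hs.2)
    refine (hd.congr_of_eventuallyEq ?_ (h s ⟨hs.1, hs.2.le⟩))
    filter_upwards [Icc_mem_nhdsGE hs.2] with x hx
    exact h x ⟨hs.1.trans hx.1, hx.2⟩
  · simpa using h t ⟨le_rfl, htT⟩

/-- The process `b (v(s) + a e^{as} ∫_0^s e^{-au} v(u) du)`, which solves `dO = a O ds + b dv`. -/
noncomputable def ouPath (a b : ℝ) (v : ℝ → ℝ) (s : ℝ) : ℝ :=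
  b * (v s + a * (Real.exp (a * s) * ∫ u in (0 : ℝ)..s, Real.exp (-(a * u)) * v u))

/-- The solution of `dx = a x ds + b dv` that starts at time `t` from `y`. -/
noncomputable def ouFlow (a b : ℝ) (v : ℝ → ℝ) (t y s : ℝ) : ℝ :=
  ouPath a b v s + Real.exp (a * (s - t)) * (y - ouPath a b v t)

theorem continuous_ouPath {a b : ℝ} {v : ℝ → ℝ} (hv : Continuous v) :
    Continuous (ouPath a b v) := by
  have : Continuous fun s => ∫ u in (0 : ℝ)..s, Real.exp (-(a * u)) * v u :=
    intervalIntegral.continuous_primitive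
      (fun _ _ => (by fun_prop : Continuous _).intervalIntegrable _ _) 0
  unfold ouPath
  fun_prop

theorem continuous_ouFlow {a b : ℝ} {v : ℝ → ℝ} (hv : Continuous v) :
    Continuous fun p : ℝ × ℝ × ℝ => ouFlow a b v p.1 p.2.1 p.2.2 := by
  have := continuous_ouPath (a := a) (b := b) hv
  unfold ouFlow
  fun_prop

theorem ouPath_sub {a b : ℝ} {v : ℝ → ℝ} (hv : Continuous v) (t s : ℝ) :
    ouPath a b v s - ouPath a b v t = a * (∫ u in t..s, ouPath a b v u) + b * (v s - v t) := by
  set I : ℝ → ℝ := fun s => ∫ u in (0 : ℝ)..s, Real.exp (-(a * u)) * v u with hI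
  have hg : Continuous fun u => Real.exp (-(a * u)) * v u := by fun_prop
  have hO := continuous_ouPath (a := a) (b := b) hv
  have hderiv : ∀ x, HasDerivAt (fun s => b * (Real.exp (a * s) * I s)) (ouPath a b v x) x := by
    intro x
    have h1 : HasDerivAt I (Real.exp (-(a * x)) * v x) x :=
      (hg.integral_hasStrictDerivAt 0 x).hasDerivAt
    have h2 : HasDerivAt (fun s => Real.exp (a * s)) (Real.exp (a * x) * a) x := by
      simpa using ((hasDerivAt_id x).const_mul a).exp
    refine ((h2.mul h1).const_mul b).congr_deriv ?_
    have h3 : Real.exp (a * x) * (Real.exp (-(a * x)) * v x) = v x := by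
      rw [← mul_assoc, ← Real.exp_add]; simp
    rw [h3, ouPath]
    ring
  rw [intervalIntegral.integral_eq_sub_of_hasDerivAt (fun x _ => hderiv x)
    (hO.intervalIntegrable _ _)]
  simp only [ouPath, hI]
  ring

theorem ouFlow_eq {a b : ℝ} {v : ℝ → ℝ} (hv : Continuous v) (t y s : ℝ) :
    ouFlow a b v t y s = y + a * (∫ u in t..s, ouFlow a b v t y u) + b * (v s - v t) := by
  have hO := continuous_ouPath (a := a) (b := b) hv
  have hderiv : ∀ x, HasDerivAt (fun s => Real.exp (a * (s - t)) * (y - ouPath a b v t))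
      (a * (Real.exp (a * (x - t)) * (y - ouPath a b v t))) x := by
    intro x
    have := ((((hasDerivAt_id x).sub_const t).const_mul a).exp).mul_const (y - ouPath a b v t)
    refine this.congr_deriv ?_
    simp only [id]
    ring
  have h1 : a * (∫ u in t..s, Real.exp (a * (u - t)) * (y - ouPath a b v t))
      = (Real.exp (a * (s - t)) - 1) * (y - ouPath a b v t) := by
    rw [← intervalIntegral.integral_const_mul,
      intervalIntegral.integral_eq_sub_of_hasDerivAt (fun x _ => hderiv x)
        ((by fun_prop : Continuous _).intervalIntegrable _ _)]
    simp
    ring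
  simp only [ouFlow]
  rw [intervalIntegral.integral_add (hO.intervalIntegrable _ _)
    ((by fun_prop : Continuous _).intervalIntegrable _ _), mul_add, h1]
  linear_combination ouPath_sub (a := a) (b := b) hv t s

/-- Joint continuity in time and measurability of each coordinate make an interval integral
depend measurably on the random parameter. -/
theorem measurable_intervalIntegral {Ω : Type*} [MeasurableSpace Ω] {g : ℝ → Ω → ℝ}
    (hc : ∀ ω, Continuous (g · ω)) (hm : ∀ u, Measurable (g u)) (a b : ℝ) :
    Measurable fun ω => ∫ u in a..b, g u ω := by
  have h : StronglyMeasurable (Function.uncurry g) :=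
    stronglyMeasurable_uncurry_of_continuous_of_stronglyMeasurable hc
      fun u => (hm u).stronglyMeasurable
  simp only [intervalIntegral]
  exact h.integral_prod_left.measurable.sub h.integral_prod_left.measurable

theorem measurable_ouPath {Ω : Type*} [MeasurableSpace Ω] {a b : ℝ} {V : ℝ → Ω → ℝ}
    (hc : ∀ ω, Continuous (V · ω)) (hm : ∀ u, Measurable (V u)) (s : ℝ) :
    Measurable fun ω => ouPath a b (V · ω) s := by
  have h := measurable_intervalIntegral (g := fun u ω => Real.exp (-(a * u)) * V u ω)
    (fun ω => by have := hc ω; fun_prop) (fun u => (hm u).const_mul _) 0 s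
  have := hm s
  unfold ouPath
  fun_prop

/-- A random field indexed by `(t, y, s)`, all of whose realizations are jointly continuous and all
of whose coordinates are measurable. Both hold for every `ω`, not just almost surely. -/
structure IsContinuousField {Ω : Type*} [MeasurableSpace Ω] (Z : ℝ → ℝ → ℝ → Ω → ℝ) : Prop where
  continuous : ∀ ω, Continuous fun p : ℝ × ℝ × ℝ => Z p.1 p.2.1 p.2.2 ω
  measurable : ∀ t y s, Measurable (Z t y s)

namespace OUMarket

variable (M : OUMarket) {Ω : Type*} [MeasurableSpace Ω] {P : Measure Ω}

/-- For each starting point `(t, y)`, a solution of the Ornstein–Uhlenbeck equation is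
indistinguishable from the explicit one, driven by a regular version of the Brownian motion. -/
theorem exists_continuousField {U : ℝ≥0 → Ω → ℝ} (hU : IsBrownianReal U P)
    {η : ℝ → ℝ → ℝ → Ω → ℝ} (hη : M.IsOUFlow P U η) :
    ∃ Z : ℝ → ℝ → ℝ → Ω → ℝ, IsContinuousField Z ∧
      ∀ t ∈ Icc M.T₀ M.T, ∀ y, ∀ᵐ ω ∂P, ∀ s ∈ Icc t M.T, η t y s ω = Z t y s ω := by
  obtain ⟨V, hVc, hVm, hVU⟩ := exists_continuous_measurable_version
    hU.toIsPreBrownianReal.aemeasurable hU.cont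
  have hv : ∀ ω, Continuous fun s : ℝ => V s.toNNReal ω := fun ω =>
    (hVc ω).comp continuous_real_toNNReal
  refine ⟨fun t y s ω => ouFlow M.α M.β (fun s => V s.toNNReal ω) t y s,
    ⟨fun ω => continuous_ouFlow (hv ω), fun t y s => ?_⟩, fun t ht y => ?_⟩
  · have h := fun s => measurable_ouPath (a := M.α) (b := M.β) hv (fun u => hVm u.toNNReal) s
    have h1 := h s
    have h2 := h t
    unfold ouFlow
    fun_prop
  · filter_upwards [hη t ht y, hVU] with ω hω hV s hs
    set z := ouFlow M.α M.β (fun s => V s.toNNReal ω) t y with hz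
    have hzc : Continuous z := by
      have := continuous_ouFlow (a := M.α) (b := M.β) (hv ω)
      exact this.comp (by fun_prop : Continuous fun s : ℝ => (t, y, s))
    have hD : ∀ s ∈ Icc t M.T, η t y s ω - z s = 0 := by
      refine eqOn_zero_of_eq_mul_integral (a := M.α) (hω.1.sub hzc.continuousOn) fun s hs => ?_
      rw [intervalIntegral.integral_sub
        ((hω.1.mono (Icc_subset_Icc_right hs.2)).intervalIntegrable_of_Icc hs.1)
        (hzc.intervalIntegrable _ _), hω.2 s hs, hz, ouFlow_eq (hv ω) t y s, hV, hV]
      ring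
    exact sub_eq_zero.1 (hD s hs)

end OUMarket

namespace OUMarket

variable (M : OUMarket) {Ω : Type*} [MeasurableSpace Ω] {P : Measure Ω}

/-! ### Elementary bounds for the market constants -/

theorem one_sub_γ_pos : 0 < 1 - M.γ := sub_pos.2 M.γ_lt_one

theorem one_lt_qStar : 1 < M.qStar := by
  rw [qStar, lt_div_iff₀ M.one_sub_γ_pos]
  linarith [M.γ_pos]

theorem qStar_pos : 0 < M.qStar := one_pos.trans M.one_lt_qStar

theorem Ttilde_pos : 0 < M.Ttilde := sub_pos.2 M.T₀_lt_T

theorem σ_pos (y : ℝ) : 0 < M.σ y := by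
  obtain ⟨c, hc, h⟩ := M.σ_lower
  exact hc.trans_le (h y)

theorem Q_nonneg (y : ℝ) : 0 ≤ M.Q y := by
  have := M.one_sub_γ_pos
  have := M.γ_pos
  have := M.r_nonneg
  unfold Q
  positivity

theorem continuous_Q : Continuous M.Q := by
  have := M.σ_differentiable.continuous
  have := fun y => (M.σ_pos y).ne'
  unfold Q θ
  fun_prop (disch := assumption)

theorem bddAbove_range_Q : BddAbove (range M.Q) := by
  obtain ⟨c, hc, h⟩ := M.σ_lower
  refine ⟨M.γ * (M.r + (|M.μ - M.r| / c) ^ 2 / (2 * (1 - M.γ))), ?_⟩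
  rintro _ ⟨y, rfl⟩
  have := M.one_sub_γ_pos
  have := M.γ_pos
  have hθ : |M.θ y| ≤ |M.μ - M.r| / c := by
    rw [θ, abs_div, abs_of_pos (M.σ_pos y)]
    exact div_le_div_of_nonneg_left (abs_nonneg _) hc (h y)
  unfold Q
  gcongr

theorem Q_le_QStar (y : ℝ) : M.Q y ≤ M.QStar := le_ciSup M.bddAbove_range_Q y

theorem QStar_nonneg : 0 ≤ M.QStar := (M.Q_nonneg 0).trans (M.Q_le_QStar 0)

theorem one_le_rStar : 1 ≤ M.rStar := by
  have h1 := M.Ttilde_pos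
  have h2 : 1 ≤ Real.exp (M.QStar * M.Ttilde) :=
    Real.one_le_exp (mul_nonneg M.QStar_nonneg h1.le)
  unfold rStar
  nlinarith

theorem kappa_pos {ζ : ℝ} (hζ : 0 < ζ) : 0 < M.kappa ζ := by
  have := M.QStar_nonneg
  unfold kappa
  linarith

/-- On `[1, ∞)` the power `x ^ (1 - q_*)` is Lipschitz with constant `q_* - 1`. -/
theorem abs_rpow_sub_rpow_le {a b : ℝ} (ha : 1 ≤ a) (hb : 1 ≤ b) :
    |a ^ (1 - M.qStar) - b ^ (1 - M.qStar)| ≤ (M.qStar - 1) * |a - b| := by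
  have hq := M.one_lt_qStar
  refine (convex_Ici (1 : ℝ)).norm_image_sub_le_of_norm_hasDerivWithin_le
    (f := fun x => x ^ (1 - M.qStar)) (f' := fun x => (1 - M.qStar) * x ^ (1 - M.qStar - 1))
    (fun x hx => ?_) (fun x hx => ?_) hb ha
  · exact (Real.hasDerivAt_rpow_const (Or.inl (one_pos.trans_le hx).ne')).hasDerivWithinAt
  · have hx0 : (0 : ℝ) < x := one_pos.trans_le hx
    rw [Real.norm_eq_abs, abs_mul, abs_of_neg (by linarith),
      abs_of_pos (Real.rpow_pos_of_pos hx0 _)]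
    have := Real.rpow_le_one_of_one_le_of_nonpos hx (by linarith : 1 - M.qStar - 1 ≤ 0)
    nlinarith

/-! ### The Feynman–Kac operator of a continuous random field -/

section field

variable {Z : ℝ → ℝ → ℝ → Ω → ℝ}

theorem continuous_G (hZ : IsContinuousField Z) (ω : Ω) :
    Continuous fun p : ℝ × ℝ × ℝ => M.G Z p.1 p.2.1 p.2.2 ω := by
  have hc : Continuous (Function.uncurry fun (p : ℝ × ℝ × ℝ) (u : ℝ) =>
      M.Q (Z p.1 p.2.2 u ω)) :=
    M.continuous_Q.comp ((hZ.continuous ω).comp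
      (by fun_prop : Continuous fun x : (ℝ × ℝ × ℝ) × ℝ => (x.1.1, x.1.2.2, x.2)))
  have hi : ∀ (p : ℝ × ℝ × ℝ) (a b : ℝ),
      IntervalIntegrable (fun u => M.Q (Z p.1 p.2.2 u ω)) volume a b := fun p a b =>
    (hc.comp (by fun_prop : Continuous fun u : ℝ => (p, u))).intervalIntegrable _ _
  have h1 := intervalIntegral.continuous_parametric_intervalIntegral_of_continuous
    (μ := volume) (a₀ := 0) hc (s := fun p => p.2.1) (by fun_prop)
  have h2 := intervalIntegral.continuous_parametric_intervalIntegral_of_continuous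
    (μ := volume) (a₀ := 0) hc (s := fun p => p.1) (by fun_prop)
  refine Real.continuous_exp.comp ((h1.sub h2).congr fun p => ?_)
  exact intervalIntegral.integral_interval_sub_left (hi p _ _) (hi p _ _)

theorem measurable_G (hZ : IsContinuousField Z) (t s y : ℝ) : Measurable (M.G Z t s y) := by
  refine Real.measurable_exp.comp (measurable_intervalIntegral
    (g := fun u ω => M.Q (Z t y u ω)) (fun ω => ?_) (fun u => ?_) t s)
  · exact M.continuous_Q.comp ((hZ.continuous ω).comp
      (by fun_prop : Continuous fun u : ℝ => (t, y, u)))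
  · exact M.continuous_Q.measurable.comp (hZ.measurable t y u)

theorem G_pos {Ω' : Type*} (Z : ℝ → ℝ → ℝ → Ω' → ℝ) (t s y : ℝ) (ω : Ω') : 0 < M.G Z t s y ω :=
  Real.exp_pos _

theorem one_le_G {Ω' : Type*} {Z : ℝ → ℝ → ℝ → Ω' → ℝ} {t s : ℝ} (hts : t ≤ s) (y : ℝ) (ω : Ω') :
    1 ≤ M.G Z t s y ω :=
  Real.one_le_exp (intervalIntegral.integral_nonneg hts fun _ _ => M.Q_nonneg _)

theorem G_le (hZ : IsContinuousField Z) {t s : ℝ} (hts : t ≤ s) (y : ℝ) (ω : Ω) :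
    M.G Z t s y ω ≤ Real.exp (M.QStar * (s - t)) := by
  refine Real.exp_le_exp.2 ?_
  have hc : Continuous fun u => M.Q (Z t y u ω) := M.continuous_Q.comp ((hZ.continuous ω).comp
      (by fun_prop : Continuous fun u : ℝ => (t, y, u)))
  refine (intervalIntegral.integral_mono_on hts (hc.intervalIntegrable _ _)
    (intervalIntegrable_const (c := M.QStar)) fun u _ => M.Q_le_QStar _).trans_eq ?_
  simp [mul_comm]

theorem G_le_of_mem (hZ : IsContinuousField Z) {t s : ℝ} (ht : M.T₀ ≤ t) (hts : t ≤ s)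
    (hs : s ≤ M.T) (y : ℝ) (ω : Ω) : M.G Z t s y ω ≤ Real.exp (M.QStar * M.Ttilde) := by
  refine (M.G_le hZ hts y ω).trans (Real.exp_le_exp.2 ?_)
  have := M.QStar_nonneg
  unfold Ttilde
  gcongr

/-- The bound holds for either order of `t` and `s`, since `𝒢 ≤ 1` when `s ≤ t`. -/
theorem norm_G_le (hZ : IsContinuousField Z) {t s : ℝ} (ht : t ∈ Icc M.T₀ M.T)
    (hs : s ∈ Icc M.T₀ M.T) (y : ℝ) (ω : Ω) :
    ‖M.G Z t s y ω‖ ≤ Real.exp (M.QStar * M.Ttilde) := by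
  rw [Real.norm_eq_abs, abs_of_pos (M.G_pos Z t s y ω)]
  rcases le_total t s with h | h
  · exact M.G_le_of_mem hZ ht.1 h hs.2 y ω
  · refine Real.exp_le_exp.2 (le_trans ?_ (mul_nonneg M.QStar_nonneg M.Ttilde_pos.le))
    rw [intervalIntegral.integral_symm, neg_nonpos]
    exact intervalIntegral.integral_nonneg h fun _ _ => M.Q_nonneg _

theorem integrable_G [IsProbabilityMeasure P] (hZ : IsContinuousField Z) {t s : ℝ}
    (ht : t ∈ Icc M.T₀ M.T) (hs : s ∈ Icc M.T₀ M.T) (y : ℝ) : Integrable (M.G Z t s y) P :=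
  Integrable.of_bound (M.measurable_G hZ t s y).aestronglyMeasurable _
    (ae_of_all _ fun ω => M.norm_G_le hZ ht hs y ω)

variable {f g : M.K → ℝ}

theorem rpow_mem_Ioc {x : ℝ} (hx : 1 ≤ x) : x ^ (1 - M.qStar) ∈ Ioc (0 : ℝ) 1 :=
  ⟨Real.rpow_pos_of_pos (one_pos.trans_le hx) _,
    Real.rpow_le_one_of_one_le_of_nonpos hx (by linarith [M.one_lt_qStar])⟩

theorem measurable_integrand (hZ : IsContinuousField Z) (hf : f ∈ M.X) (t s y : ℝ) :
    Measurable fun ω => (f (projIcc M.T₀ M.T M.T₀_lt_T.le s, Z t y s ω)) ^ (1 - M.qStar)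
      * M.G Z t s y ω := by
  have h1 := hf.1.measurable.comp
    (measurable_const.prodMk (hZ.measurable t y s) :
      Measurable fun ω => (projIcc M.T₀ M.T M.T₀_lt_T.le s, Z t y s ω))
  exact (h1.pow_const _).mul (M.measurable_G hZ t s y)

theorem norm_integrand_le (hZ : IsContinuousField Z) (hf : f ∈ M.X) {t s : ℝ}
    (ht : t ∈ Icc M.T₀ M.T) (hs : s ∈ Icc M.T₀ M.T) (y : ℝ) (ω : Ω) :
    ‖(f (projIcc M.T₀ M.T M.T₀_lt_T.le s, Z t y s ω)) ^ (1 - M.qStar) * M.G Z t s y ω‖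
      ≤ Real.exp (M.QStar * M.Ttilde) := by
  have h := M.rpow_mem_Ioc (hf.2 (projIcc M.T₀ M.T M.T₀_lt_T.le s, Z t y s ω)).1
  rw [norm_mul, Real.norm_eq_abs, abs_of_pos h.1]
  exact (mul_le_of_le_one_left (norm_nonneg _) h.2).trans (M.norm_G_le hZ ht hs y ω)

theorem integrable_integrand [IsProbabilityMeasure P] (hZ : IsContinuousField Z) (hf : f ∈ M.X)
    {t s : ℝ} (ht : t ∈ Icc M.T₀ M.T) (hs : s ∈ Icc M.T₀ M.T) (y : ℝ) :
    Integrable (fun ω => (f (projIcc M.T₀ M.T M.T₀_lt_T.le s, Z t y s ω)) ^ (1 - M.qStar)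
      * M.G Z t s y ω) P :=
  Integrable.of_bound (M.measurable_integrand hZ hf t s y).aestronglyMeasurable _
    (ae_of_all _ fun ω => M.norm_integrand_le hZ hf ht hs y ω)

/-- Dominated convergence: `ℋ_f` is jointly continuous once its second time argument is projected
onto `[T₀, T]`. -/
theorem continuous_H [IsProbabilityMeasure P] (hZ : IsContinuousField Z) (hf : f ∈ M.X) :
    Continuous fun q : M.K × ℝ =>
      M.H P Z f q.1.1 (projIcc M.T₀ M.T M.T₀_lt_T.le q.2) q.1.2 := by
  refine continuous_of_dominated
    (fun q => (M.measurable_integrand hZ hf _ _ _).aestronglyMeasurable)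
    (fun q => ae_of_all _ fun ω => M.norm_integrand_le hZ hf q.1.1.2 (Subtype.prop _) _ ω)
    (integrable_const _) (ae_of_all _ fun ω => ?_)
  have hp : Continuous fun q : M.K × ℝ => ((projIcc M.T₀ M.T M.T₀_lt_T.le q.2 : Icc _ _) : ℝ) :=
    continuous_subtype_val.comp (continuous_projIcc.comp continuous_snd)
  have hG := (M.continuous_G hZ ω).comp
    (by fun_prop : Continuous fun q : M.K × ℝ =>
      ((q.1.1 : ℝ), ((projIcc M.T₀ M.T M.T₀_lt_T.le q.2 : Icc _ _) : ℝ), q.1.2))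
  have hZc := (hZ.continuous ω).comp
    (by fun_prop : Continuous fun q : M.K × ℝ =>
      ((q.1.1 : ℝ), q.1.2, ((projIcc M.T₀ M.T M.T₀_lt_T.le q.2 : Icc _ _) : ℝ)))
  have hfc := hf.1.comp (((continuous_projIcc (h := M.T₀_lt_T.le)).comp hp).prodMk hZc)
  exact (hfc.rpow_const fun q => Or.inl (one_pos.trans_le (hf.2 _).1).ne').mul hG

theorem intervalIntegrable_H [IsProbabilityMeasure P] (hZ : IsContinuousField Z) (hf : f ∈ M.X)
    (p : M.K) : IntervalIntegrable (fun s => M.H P Z f p.1 s p.2) volume p.1 M.T := by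
  refine ((M.continuous_H (P := P) hZ hf).comp
    (by fun_prop : Continuous fun s : ℝ => (p, s))).continuousOn.congr ?_
    |>.intervalIntegrable_of_Icc p.1.2.2
  intro s hs
  simp [projIcc_of_mem M.T₀_lt_T.le ⟨p.1.2.1.trans hs.1, hs.2⟩]

theorem continuous_integral_G [IsProbabilityMeasure P] (hZ : IsContinuousField Z) :
    Continuous fun p : M.K => ∫ ω, M.G Z p.1 M.T p.2 ω ∂P := by
  have hT : M.T ∈ Icc M.T₀ M.T := ⟨M.T₀_lt_T.le, le_rfl⟩
  have hp : Continuous fun p : M.K => ((p.1 : ℝ), M.T, p.2) :=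
    (continuous_subtype_val.comp continuous_fst).prodMk (continuous_const.prodMk continuous_snd)
  refine continuous_of_dominated (F := fun (p : M.K) ω => M.G Z p.1 M.T p.2 ω)
    (bound := fun _ => Real.exp (M.QStar * M.Ttilde))
    (fun p => (M.measurable_G hZ p.1 M.T p.2).aestronglyMeasurable)
    (fun p => ae_of_all _ fun ω => M.norm_G_le hZ p.1.2 hT p.2 ω) (integrable_const _)
    (ae_of_all _ fun ω => ?_)
  exact Continuous.comp (g := fun q : ℝ × ℝ × ℝ => M.G Z q.1 q.2.1 q.2.2 ω)
    (f := fun p : M.K => ((p.1 : ℝ), M.T, p.2)) (M.continuous_G hZ ω) hp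

theorem continuous_integral_H [IsProbabilityMeasure P] (hZ : IsContinuousField Z)
    (hf : f ∈ M.X) : Continuous fun p : M.K => ∫ s in M.T..(p.1 : ℝ),
      M.H P Z f p.1 (projIcc M.T₀ M.T M.T₀_lt_T.le s) p.2 := by
  have h := M.continuous_H (P := P) hZ hf
  have hs : Continuous fun p : M.K => (p.1 : ℝ) := continuous_subtype_val.comp continuous_fst
  exact intervalIntegral.continuous_parametric_intervalIntegral_of_continuous
    (f := fun (p : M.K) (s : ℝ) => M.H P Z f p.1 (projIcc M.T₀ M.T M.T₀_lt_T.le s) p.2) h hs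

theorem continuous_feynmanKac [IsProbabilityMeasure P] (hZ : IsContinuousField Z)
    (hf : f ∈ M.X) : Continuous (M.feynmanKac P Z f) := by
  have h3 : ∀ p : M.K, ∫ s in (p.1 : ℝ)..M.T, M.H P Z f p.1 s p.2
      = -∫ s in M.T..(p.1 : ℝ), M.H P Z f p.1 (projIcc M.T₀ M.T M.T₀_lt_T.le s) p.2 := by
    intro p
    rw [← intervalIntegral.integral_symm]
    refine intervalIntegral.integral_congr fun s hs => ?_
    rw [uIcc_of_le p.1.2.2] at hs
    simp only [projIcc_of_mem M.T₀_lt_T.le ⟨p.1.2.1.trans hs.1, hs.2⟩]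
  have h4 : M.feynmanKac P Z f = fun p : M.K => (∫ ω, M.G Z p.1 M.T p.2 ω ∂P) + 1 / M.qStar *
      -∫ s in M.T..(p.1 : ℝ), M.H P Z f p.1 (projIcc M.T₀ M.T M.T₀_lt_T.le s) p.2 :=
    funext fun p => by rw [feynmanKac, h3 p]
  rw [h4]
  exact (M.continuous_integral_G hZ).add (continuous_const.mul (M.continuous_integral_H hZ hf).neg)

theorem H_mem_Icc [IsProbabilityMeasure P] (hZ : IsContinuousField Z) (hf : f ∈ M.X) {t s : ℝ}
    (ht : t ∈ Icc M.T₀ M.T) (hs : s ∈ Icc M.T₀ M.T) (y : ℝ) :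
    M.H P Z f t s y ∈ Icc 0 (Real.exp (M.QStar * M.Ttilde)) := by
  constructor
  · exact integral_nonneg fun ω => mul_nonneg (M.rpow_mem_Ioc (hf.2 _).1).1.le (Real.exp_pos _).le
  · refine (integral_mono (M.integrable_integrand hZ hf ht hs y) (integrable_const _) fun ω =>
      (le_abs_self _).trans (M.norm_integrand_le hZ hf ht hs y ω)).trans_eq ?_
    simp

theorem feynmanKac_mem_X_of_field [IsProbabilityMeasure P] (hZ : IsContinuousField Z)
    (hf : f ∈ M.X) : M.feynmanKac P Z f ∈ M.X := by
  refine ⟨M.continuous_feynmanKac hZ hf, fun p => ?_⟩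
  obtain ⟨⟨t, ht⟩, y⟩ := p
  have hT : M.T ∈ Icc M.T₀ M.T := ⟨M.T₀_lt_T.le, le_rfl⟩
  have hGi := M.integrable_G (P := P) hZ ht hT y
  have hG1 : 1 ≤ ∫ ω, M.G Z t M.T y ω ∂P := by
    simpa using integral_mono (integrable_const 1) hGi fun ω => M.one_le_G ht.2 y ω
  have hG2 : ∫ ω, M.G Z t M.T y ω ∂P ≤ Real.exp (M.QStar * M.Ttilde) := by
    simpa using integral_mono hGi (integrable_const _)
      fun ω => M.G_le_of_mem hZ ht.1 ht.2 le_rfl y ω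
  have hH : ∀ s ∈ Icc t M.T, M.H P Z f t s y ∈ Icc 0 (Real.exp (M.QStar * M.Ttilde)) :=
    fun s hs => M.H_mem_Icc hZ hf ht ⟨ht.1.trans hs.1, hs.2⟩ y
  have hH1 : 0 ≤ ∫ s in t..M.T, M.H P Z f t s y :=
    intervalIntegral.integral_nonneg ht.2 fun s hs => (hH s hs).1
  have hH2 : ∫ s in t..M.T, M.H P Z f t s y ≤ M.Ttilde * Real.exp (M.QStar * M.Ttilde) := by
    have h := intervalIntegral.integral_mono_on ht.2
      (M.intervalIntegrable_H (P := P) hZ hf (⟨t, ht⟩, y))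
      (intervalIntegrable_const (c := Real.exp (M.QStar * M.Ttilde))) fun s hs => (hH s hs).2
    refine h.trans ?_
    rw [intervalIntegral.integral_const, smul_eq_mul, Ttilde]
    gcongr
    exact ht.1
  have hq : 1 / M.qStar ≤ 1 := (div_le_one M.qStar_pos).2 M.one_lt_qStar.le
  have hq0 : 0 ≤ 1 / M.qStar := (one_div_pos.2 M.qStar_pos).le
  constructor
  · exact le_add_of_le_of_nonneg hG1 (mul_nonneg hq0 hH1)
  · have := mul_le_of_le_one_left hH1 hq
    simp only [feynmanKac, rStar]
    linarith

/-- A weighted bound on `f - g` is carried over to `ℋ_f - ℋ_g`. -/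
theorem abs_H_sub_H_le [IsProbabilityMeasure P] (hZ : IsContinuousField Z) (hf : f ∈ M.X)
    (hg : g ∈ M.X) {κ R : ℝ}
    (hR : ∀ p : M.K, |f p - g p| ≤ R * Real.exp (κ * (M.T - p.1)))
    {t s : ℝ} (ht : M.T₀ ≤ t) (hts : t ≤ s) (hs : s ≤ M.T) (y : ℝ) :
    |M.H P Z f t s y - M.H P Z g t s y| ≤ (M.qStar - 1) * (R * Real.exp (κ * (M.T - s)))
      * Real.exp (M.QStar * (s - t)) := by
  have ht' : t ∈ Icc M.T₀ M.T := ⟨ht, hts.trans hs⟩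
  have hs' : s ∈ Icc M.T₀ M.T := ⟨ht.trans hts, hs⟩
  rw [H, H, ← integral_sub (M.integrable_integrand hZ hf ht' hs' y)
    (M.integrable_integrand hZ hg ht' hs' y)]
  have := norm_integral_le_of_norm_le_const (μ := P)
    (f := fun ω => (f (projIcc M.T₀ M.T M.T₀_lt_T.le s, Z t y s ω)) ^ (1 - M.qStar)
      * M.G Z t s y ω - (g (projIcc M.T₀ M.T M.T₀_lt_T.le s, Z t y s ω)) ^ (1 - M.qStar)
      * M.G Z t s y ω)
    (C := (M.qStar - 1) * (R * Real.exp (κ * (M.T - s))) * Real.exp (M.QStar * (s - t)))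
    (ae_of_all _ fun ω => ?_)
  · simpa using this
  rw [← sub_mul, norm_mul, Real.norm_eq_abs, Real.norm_eq_abs,
    abs_of_pos (M.G_pos Z t s y ω)]
  have hp := hR (projIcc M.T₀ M.T M.T₀_lt_T.le s, Z t y s ω)
  have hq := M.one_lt_qStar
  have h1 := (M.abs_rpow_sub_rpow_le (hf.2 (projIcc M.T₀ M.T M.T₀_lt_T.le s, Z t y s ω)).1
    (hg.2 (projIcc M.T₀ M.T M.T₀_lt_T.le s, Z t y s ω)).1).trans
    (mul_le_mul_of_nonneg_left hp (by linarith))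
  rw [projIcc_of_mem M.T₀_lt_T.le hs'] at h1 ⊢
  exact mul_le_mul h1 (M.G_le hZ hts y ω) (Real.exp_pos _).le ((abs_nonneg _).trans h1)

/-- The contraction estimate in weighted form: the weight `e^{ϰ(T-t)}` beats the growth
`e^{Q_*(s-t)}` of `𝒢` by `e^{-(ζ+1)(s-t)}`, whose integral is at most `1 / (1 + ζ)`. -/
theorem abs_feynmanKac_sub_le [IsProbabilityMeasure P] (hZ : IsContinuousField Z) (hf : f ∈ M.X)
    (hg : g ∈ M.X) {ζ R : ℝ} (hζ : 0 < ζ) (hR0 : 0 ≤ R)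
    (hR : ∀ p : M.K, |f p - g p| ≤ R * Real.exp (M.kappa ζ * (M.T - p.1))) (p : M.K) :
    |M.feynmanKac P Z f p - M.feynmanKac P Z g p|
      ≤ 1 / (1 + ζ) * R * Real.exp (M.kappa ζ * (M.T - p.1)) := by
  obtain ⟨⟨t, ht⟩, y⟩ := p
  have hq := M.one_lt_qStar
  have hq0 := M.qStar_pos
  have hz : 0 < 1 + ζ := by linarith
  have hexp : ∫ s in t..M.T, Real.exp (-((1 + ζ) * (s - t))) ≤ 1 / (1 + ζ) := by
    have hd : ∀ x, HasDerivAt (fun s => -(1 / (1 + ζ)) * Real.exp (-((1 + ζ) * (s - t))))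
        (Real.exp (-((1 + ζ) * (x - t)))) x := by
      intro x
      refine (((((hasDerivAt_id x).sub_const t).const_mul (1 + ζ)).neg.exp).const_mul
        (-(1 / (1 + ζ)))).congr_deriv ?_
      simp only [id, Pi.neg_apply]
      field_simp
    rw [intervalIntegral.integral_eq_sub_of_hasDerivAt (fun x _ => hd x)
      ((by fun_prop : Continuous fun s => Real.exp (-((1 + ζ) * (s - t)))).intervalIntegrable _ _)]
    have : 0 < 1 / (1 + ζ) * Real.exp (-((1 + ζ) * (M.T - t))) := by positivity
    simp only [sub_self, mul_zero, neg_zero, Real.exp_zero]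
    linarith
  have hbound : |∫ s in t..M.T, (M.H P Z f t s y - M.H P Z g t s y)|
      ≤ ∫ s in t..M.T, (M.qStar - 1) * R * Real.exp (M.kappa ζ * (M.T - t))
        * Real.exp (-((1 + ζ) * (s - t))) := by
    refine intervalIntegral.norm_integral_le_of_norm_le (μ := volume)
      (f := fun s => M.H P Z f t s y - M.H P Z g t s y) ht.2 (ae_of_all _ fun s hs => ?_)
      ((by fun_prop : Continuous fun s => (M.qStar - 1) * R * Real.exp (M.kappa ζ * (M.T - t))
        * Real.exp (-((1 + ζ) * (s - t)))).intervalIntegrable _ _)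
    refine (M.abs_H_sub_H_le hZ hf hg hR ht.1 hs.1.le hs.2 y).trans_eq ?_
    have : Real.exp (M.kappa ζ * (M.T - s)) * Real.exp (M.QStar * (s - t))
        = Real.exp (M.kappa ζ * (M.T - t)) * Real.exp (-((1 + ζ) * (s - t))) := by
      rw [← Real.exp_add, ← Real.exp_add, kappa]
      ring_nf
    linear_combination (M.qStar - 1) * R * this
  rw [intervalIntegral.integral_const_mul] at hbound
  have heq : M.feynmanKac P Z f (⟨t, ht⟩, y) - M.feynmanKac P Z g (⟨t, ht⟩, y)
      = 1 / M.qStar * ∫ s in t..M.T, (M.H P Z f t s y - M.H P Z g t s y) := by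
    rw [intervalIntegral.integral_sub (M.intervalIntegrable_H hZ hf (⟨t, ht⟩, y))
      (M.intervalIntegrable_H hZ hg (⟨t, ht⟩, y))]
    simp only [feynmanKac]
    ring
  rw [heq, abs_mul, abs_of_pos (one_div_pos.2 hq0)]
  set E := Real.exp (M.kappa ζ * (M.T - t))
  have hE : 0 < E := Real.exp_pos _
  calc 1 / M.qStar * |∫ s in t..M.T, (M.H P Z f t s y - M.H P Z g t s y)|
      ≤ 1 / M.qStar * ((M.qStar - 1) * R * E * (1 / (1 + ζ))) := by
        have h0 : 0 ≤ (M.qStar - 1) * R * E :=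
          mul_nonneg (mul_nonneg (by linarith) hR0) hE.le
        exact mul_le_mul_of_nonneg_left (hbound.trans (mul_le_mul_of_nonneg_left hexp h0))
          (one_div_pos.2 hq0).le
    _ = (M.qStar - 1) / M.qStar * (1 / (1 + ζ) * R * E) := by ring
    _ ≤ 1 / (1 + ζ) * R * E :=
        mul_le_of_le_one_left (by positivity) ((div_le_one hq0).2 (by linarith))

end field

/-- The operator depends on the solution only through its indistinguishability class at each
starting point. -/
theorem feynmanKac_congr {η Z : ℝ → ℝ → ℝ → Ω → ℝ}
    (h : ∀ t ∈ Icc M.T₀ M.T, ∀ y, ∀ᵐ ω ∂P, ∀ s ∈ Icc t M.T, η t y s ω = Z t y s ω) :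
    M.feynmanKac P η = M.feynmanKac P Z := by
  have hG : ∀ t ∈ Icc M.T₀ M.T, ∀ y, ∀ᵐ ω ∂P, ∀ s ∈ Icc t M.T,
      M.G η t s y ω = M.G Z t s y ω := by
    intro t ht y
    filter_upwards [h t ht y] with ω hω s hs
    refine congrArg Real.exp (intervalIntegral.integral_congr fun u hu => ?_)
    rw [uIcc_of_le hs.1] at hu
    simp only [hω u ⟨hu.1, hu.2.trans hs.2⟩]
  funext f ⟨⟨t, ht⟩, y⟩
  simp only [feynmanKac]
  congr 1
  · refine integral_congr_ae ?_
    filter_upwards [hG t ht y] with ω hω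
    exact hω _ ⟨ht.2, le_rfl⟩
  · congr 1
    refine intervalIntegral.integral_congr fun s hs => integral_congr_ae ?_
    rw [uIcc_of_le ht.2] at hs
    filter_upwards [hG t ht y, h t ht y] with ω hω hω'
    rw [hω s hs, hω' s hs]

/-! ### The weighted metric and the fixed point -/

theorem abs_sub_le_rStar {f g : M.K → ℝ} (hf : f ∈ M.X) (hg : g ∈ M.X) (p : M.K) :
    |f p - g p| ≤ M.rStar := by
  have h1 := hf.2 p
  have h2 := hg.2 p
  rw [abs_le]
  constructor <;> linarith

theorem exp_weight_le_one {ζ : ℝ} (hζ : 0 < ζ) (p : M.K) :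
    Real.exp (-M.kappa ζ * (M.T - (p.1 : ℝ))) ≤ 1 :=
  Real.exp_le_one_iff.2
    (mul_nonpos_of_nonpos_of_nonneg (neg_nonpos.2 (M.kappa_pos hζ).le) (sub_nonneg.2 p.1.2.2))

theorem rhoStar_le {ζ : ℝ} (hζ : 0 < ζ) {f g : M.K → ℝ} {c : ℝ} (h : ∀ p, |f p - g p| ≤ c) :
    M.rhoStar ζ f g ≤ c := by
  have : Nonempty M.K := ⟨(⟨M.T, M.T₀_lt_T.le, le_rfl⟩, 0)⟩
  exact ciSup_le fun p =>
    (mul_le_of_le_one_left (abs_nonneg _) (M.exp_weight_le_one hζ p)).trans (h p)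

theorem rhoStar_nonneg (ζ : ℝ) (f g : M.K → ℝ) : 0 ≤ M.rhoStar ζ f g :=
  Real.iSup_nonneg fun _ => by positivity

theorem abs_sub_le_rhoStar_mul {ζ : ℝ} (hζ : 0 < ζ) {f g : M.K → ℝ} (hf : f ∈ M.X)
    (hg : g ∈ M.X) (p : M.K) :
    |f p - g p| ≤ M.rhoStar ζ f g * Real.exp (M.kappa ζ * (M.T - p.1)) := by
  have hb : BddAbove (range fun p : M.K =>
      Real.exp (-M.kappa ζ * (M.T - (p.1 : ℝ))) * |f p - g p|) := by
    refine ⟨M.rStar, ?_⟩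
    rintro _ ⟨p, rfl⟩
    exact (mul_le_of_le_one_left (abs_nonneg _) (M.exp_weight_le_one hζ p)).trans
      (M.abs_sub_le_rStar hf hg p)
  have h := le_ciSup hb p
  have h2 := mul_le_mul_of_nonneg_right h (Real.exp_pos (M.kappa ζ * (M.T - p.1))).le
  refine le_trans (le_of_eq ?_) h2
  have h3 : Real.exp (-M.kappa ζ * (M.T - (p.1 : ℝ))) * Real.exp (M.kappa ζ * (M.T - p.1)) = 1 := by
    rw [← Real.exp_add, Real.exp_eq_one_iff]
    ring
  linear_combination -|f p - g p| * h3

theorem abs_sub_le_exp_mul_rhoStar {ζ : ℝ} (hζ : 0 < ζ) {f g : M.K → ℝ} (hf : f ∈ M.X)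
    (hg : g ∈ M.X) (p : M.K) :
    |f p - g p| ≤ Real.exp (M.kappa ζ * M.Ttilde) * M.rhoStar ζ f g := by
  refine (M.abs_sub_le_rhoStar_mul hζ hf hg p).trans ?_
  rw [mul_comm]
  have h1 := M.kappa_pos hζ
  have h2 := M.rhoStar_nonneg ζ f g
  have h3 := p.1.2.1
  unfold Ttilde
  gcongr

theorem rhoStar_feynmanKac_le [IsProbabilityMeasure P] {Z : ℝ → ℝ → ℝ → Ω → ℝ}
    (hZ : IsContinuousField Z) {ζ : ℝ} (hζ : 0 < ζ) {f g : M.K → ℝ} (hf : f ∈ M.X)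
    (hg : g ∈ M.X) :
    M.rhoStar ζ (M.feynmanKac P Z f) (M.feynmanKac P Z g) ≤ 1 / (1 + ζ) * M.rhoStar ζ f g := by
  have : Nonempty M.K := ⟨(⟨M.T, M.T₀_lt_T.le, le_rfl⟩, 0)⟩
  refine ciSup_le fun p => ?_
  have h := M.abs_feynmanKac_sub_le (P := P) hZ hf hg hζ (M.rhoStar_nonneg ζ f g)
    (M.abs_sub_le_rhoStar_mul hζ hf hg) p
  have h2 := mul_le_mul_of_nonneg_left h (Real.exp_pos (-M.kappa ζ * (M.T - (p.1 : ℝ)))).le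
  refine h2.trans_eq ?_
  have h3 : Real.exp (-M.kappa ζ * (M.T - (p.1 : ℝ))) * Real.exp (M.kappa ζ * (M.T - p.1)) = 1 := by
    rw [← Real.exp_add, Real.exp_eq_one_iff]
    ring
  linear_combination (1 / (1 + ζ) * M.rhoStar ζ f g) * h3

theorem one_mem_X : (fun _ => 1 : M.K → ℝ) ∈ M.X :=
  ⟨continuous_const, fun _ => ⟨le_rfl, M.one_le_rStar⟩⟩

/-- Banach's fixed point theorem for the Feynman–Kac operator. It is carried out in the sup norm,
where the Picard iterates form a Cauchy sequence of geometric rate `1 / (1 + ζ)` for each `ζ`. -/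
theorem exists_fixedPoint {η : ℝ → ℝ → ℝ → Ω → ℝ}
    (hmaps : ∀ f ∈ M.X, M.feynmanKac P η f ∈ M.X)
    (hcontr : ∀ ζ : ℝ, 0 < ζ → ∀ f ∈ M.X, ∀ g ∈ M.X,
      M.rhoStar ζ (M.feynmanKac P η f) (M.feynmanKac P η g) ≤ 1 / (1 + ζ) * M.rhoStar ζ f g) :
    ∃ h ∈ M.X, M.feynmanKac P η h = h ∧ (∀ g ∈ M.X, M.feynmanKac P η g = g → g = h) ∧
      ∀ ζ : ℝ, 0 < ζ → ∀ (n : ℕ) (p : M.K),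
        |h p - M.picard P η n p| ≤ M.BStar ζ * (1 / (1 + ζ)) ^ n := by
  have hpic : ∀ n, M.picard P η n ∈ M.X := by
    intro n
    induction n with
    | zero => exact M.one_mem_X
    | succ n ih => exact hmaps _ ih
  have hstep : ∀ ζ : ℝ, 0 < ζ → ∀ n,
      M.rhoStar ζ (M.picard P η n) (M.picard P η (n + 1)) ≤ (1 / (1 + ζ)) ^ n * (1 + M.rStar) := by
    intro ζ hζ n
    induction n with
    | zero =>
      rw [pow_zero, one_mul]
      refine M.rhoStar_le hζ fun p => ?_
      linarith [M.abs_sub_le_rStar (hpic 0) (hpic 1) p]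
    | succ n ih =>
      refine (hcontr ζ hζ _ (hpic n) _ (hpic (n + 1))).trans ?_
      rw [pow_succ', mul_assoc]
      exact mul_le_mul_of_nonneg_left ih (by positivity)
  let F : ℕ → BoundedContinuousFunction M.K ℝ := fun n =>
    BoundedContinuousFunction.ofNormedAddCommGroup (M.picard P η n) (hpic n).1 M.rStar fun p => by
      have := (hpic n).2 p
      rw [Real.norm_eq_abs, abs_of_pos (by linarith)]
      exact this.2
  have hdist : ∀ ζ : ℝ, 0 < ζ → ∀ n, dist (F n) (F (n + 1)) ≤
      Real.exp (M.kappa ζ * M.Ttilde) * (1 + M.rStar) * (1 / (1 + ζ)) ^ n := by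
    intro ζ hζ n
    have hr := M.one_le_rStar
    refine (BoundedContinuousFunction.dist_le (by positivity)).2 fun p => ?_
    refine (M.abs_sub_le_exp_mul_rhoStar hζ (hpic n) (hpic (n + 1)) p).trans ?_
    rw [mul_assoc, mul_comm (1 + M.rStar)]
    exact mul_le_mul_of_nonneg_left (hstep ζ hζ n) (Real.exp_pos _).le
  have hlt : ∀ ζ : ℝ, 0 < ζ → 1 / (1 + ζ) < 1 := fun ζ hζ =>
    (div_lt_one (by linarith)).2 (by linarith)
  obtain ⟨h, hh⟩ := cauchySeq_tendsto_of_complete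
    (cauchySeq_of_le_geometric _ _ (hlt 1 one_pos) (hdist 1 one_pos))
  have hpt : ∀ p, Filter.Tendsto (fun n => M.picard P η n p) Filter.atTop (nhds (h p)) := fun p =>
    ((BoundedContinuousFunction.lipschitz_eval_const p).continuous.tendsto h).comp hh
  have hX : (h : M.K → ℝ) ∈ M.X := ⟨h.continuous, fun p =>
    ⟨ge_of_tendsto' (hpt p) fun n => ((hpic n).2 p).1,
      le_of_tendsto' (hpt p) fun n => ((hpic n).2 p).2⟩⟩
  have hrate : ∀ ζ : ℝ, 0 < ζ → ∀ (n : ℕ) (p : M.K),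
      |h p - M.picard P η n p| ≤ M.BStar ζ * (1 / (1 + ζ)) ^ n := by
    intro ζ hζ n p
    have h1 := dist_le_of_le_geometric_of_tendsto _ _ (hlt ζ hζ) (hdist ζ hζ) hh n
    rw [abs_sub_comm]
    refine ((BoundedContinuousFunction.dist_coe_le_dist p).trans h1).trans_eq ?_
    rw [BStar]
    ring
  have hfix : M.feynmanKac P η h = h := by
    -- `ℒ h` is also the limit of the iterates `h_{n+1} = ℒ h_n`.
    funext p
    refine tendsto_nhds_unique ?_ ((Filter.tendsto_add_atTop_iff_nat 1).2 (hpt p))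
    rw [tendsto_iff_dist_tendsto_zero]
    have hz : Filter.Tendsto (fun n : ℕ => Real.exp (M.kappa 1 * M.Ttilde) *
        (1 / (1 + 1) * (M.BStar 1 * (1 / (1 + 1) : ℝ) ^ n))) Filter.atTop (nhds 0) := by
      have := tendsto_pow_atTop_nhds_zero_of_lt_one (r := (1 / (1 + 1) : ℝ)) (by norm_num)
        (by norm_num)
      simpa only [mul_zero] using ((this.const_mul (M.BStar 1)).const_mul
        (1 / (1 + 1) : ℝ)).const_mul (Real.exp (M.kappa 1 * M.Ttilde))
    refine squeeze_zero (fun _ => dist_nonneg) (fun n => ?_) hz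
    rw [dist_comm, Real.dist_eq]
    refine (M.abs_sub_le_exp_mul_rhoStar one_pos (hmaps _ hX) (hpic (n + 1)) p).trans ?_
    refine mul_le_mul_of_nonneg_left ((hcontr 1 one_pos _ hX _ (hpic n)).trans ?_)
      (Real.exp_pos _).le
    exact mul_le_mul_of_nonneg_left (M.rhoStar_le one_pos (hrate 1 one_pos n)) (by norm_num)
  refine ⟨h, hX, hfix, fun g hg hgfix => ?_, hrate⟩
  have h0 := hcontr 1 one_pos g hg h hX
  rw [hgfix, hfix] at h0
  have h1 : M.rhoStar 1 g h = 0 := le_antisymm (by linarith) (M.rhoStar_nonneg 1 g h)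
  funext p
  have h2 := M.abs_sub_le_exp_mul_rhoStar one_pos hg hX p
  rw [h1, mul_zero] at h2
  exact sub_eq_zero.1 (abs_nonpos_iff.1 h2)

end OUMarket

theorem mainTheorem3 (M : OUMarket) {Ω : Type*} [MeasurableSpace Ω]
    (P : Measure Ω) [IsProbabilityMeasure P]
    (U : ℝ≥0 → Ω → ℝ) (hU : IsBrownianReal U P)
    (η : ℝ → ℝ → ℝ → Ω → ℝ) (hη : M.IsOUFlow P U η) :
    -- the operator maps `X` into itself
    (∀ f ∈ M.X, M.feynmanKac P η f ∈ M.X) ∧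
    -- it is a contraction with factor `λ = 1 / (1 + ζ)`
    (∀ ζ : ℝ, 0 < ζ → ∀ f ∈ M.X, ∀ g ∈ M.X,
      M.rhoStar ζ (M.feynmanKac P η f) (M.feynmanKac P η g)
        ≤ 1 / (1 + ζ) * M.rhoStar ζ f g) ∧
    -- it has a unique fixed point in `X`, approximated by the Picard iterates
    ∃ h ∈ M.X, M.feynmanKac P η h = h ∧
      (∀ g ∈ M.X, M.feynmanKac P η g = g → g = h) ∧
      ∀ ζ : ℝ, 0 < ζ → ∀ (n : ℕ) (p : M.K),
        |h p - M.picard P η n p| ≤ M.BStar ζ * (1 / (1 + ζ)) ^ n := by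
  obtain ⟨Z, hZ, hηZ⟩ := M.exists_continuousField hU hη
  have hcongr := M.feynmanKac_congr hηZ
  have hmaps : ∀ f ∈ M.X, M.feynmanKac P η f ∈ M.X := fun f hf =>
    hcongr ▸ M.feynmanKac_mem_X_of_field hZ hf
  have hcontr : ∀ ζ : ℝ, 0 < ζ → ∀ f ∈ M.X, ∀ g ∈ M.X,
      M.rhoStar ζ (M.feynmanKac P η f) (M.feynmanKac P η g)
        ≤ 1 / (1 + ζ) * M.rhoStar ζ f g := fun ζ hζ f hf g hg =>
    hcongr ▸ M.rhoStar_feynmanKac_le hZ hζ hf hg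
  exact ⟨hmaps, hcontr, M.exists_fixedPoint hmaps hcontr⟩
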